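/- Let $n\ge 0$ and let $\mathbf{E}$ be the set of all linear subspaces of $\mathbb{R}^n$. For $E\in\mathbf{E}$ let $P_E:\mathbb{R}^n\to\mathbb{R}^n$ be the orthogonal projection onto $E$, and equip $\mathbf{E}$ with the coarsest topology making $E\mapsto P_E$ continuous and with its Borel $\sigma$-algebra. For a Borel probability measure $\mu$ on $\mathbb{R}^n$ let $\mu_E$ be its marginal on $E$, i.e. its push-forward under the orthogonal projection $\mathbb{R}^n\to E$. We say that $\mu$ splits along $(E,E^\perp)$ if $\mu=\mu_E\otimes\mu_{E^\perp}$ (identifying $E\times E^\perp$ with $\mathbb{R}^n$ through addition), and that $\mu$ splits with respect to a Borel probability measure $\xi$ on $\mathbf{E}$ if it splits along $(E,E^\perp)$ for $\xi$-a.e. $E$. **Theorem.** Let $\mu$ be a Borel probability measure on $\mathbb{R}^n$ that splits with respect to a Borel probability measure $\xi$ on $\mathbf{E}$, and let $\lambda\ge 0$ be such that, in the sense of the order of self-adjoint operators, $$\int_{\mathbf{E}} P_E\,d\xi(E)\le(1-\lambda)\,\mathrm{id}_{\mathbb{R}^n}.$$ Let $X\sim\mu$ and let $f\in L^2(\mu)$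 be real-valued. Then $E\mapsto\operatorname{Var}(\mathbb{E}[f(X)\mid P_EX])$ and $E\mapsto\mathbb{E}[\operatorname{Var}(f(X)\mid P_EX)]$ are $\xi$-integrable, and $$\int_{\mathbf{E}}\operatorname{Var}\big(\mathbb{E}[f(X)\mid P_EX]\big)\,d\xi(E)\le(1-\lambda)\operatorname{Var}(f(X)).\tag{1}$$ Moreover, if $\lambda>0$, $$\operatorname{Var}(f(X))\le\frac1\lambda\int_{\mathbf{E}}\mathbb{E}\big[\operatorname{Var}(f(X)\mid P_EX)\big]\,d\xi(E).\tag{2}$$ The two inequalities are equivalent: for every constant $c>0$, (1) with $c$ in place of $\lambda$ holds if and only if (2) with $c$ in place of $\lambda$ holds. -/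

import Mathlib

open MeasureTheory ProbabilityTheory
open scoped MeasureTheory ProbabilityTheory

/-- The coarsest topology on the set of all linear subspaces of `ℝⁿ` for which `E ↦ P_E`
(orthogonal projection, as an operator on `ℝⁿ`) is continuous. -/
noncomputable instance subspaceTopology (n : ℕ) :
    TopologicalSpace (Submodule ℝ (EuclideanSpace ℝ (Fin n))) :=
  TopologicalSpace.induced
    (fun E : Submodule ℝ (EuclideanSpace ℝ (Fin n)) => E.starProjection) inferInstance

/-- The Borel σ-algebra on the set of linear subspaces of `ℝⁿ`. -/
noncomputable instance subspaceMeasurableSpace (n : ℕ) :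
    MeasurableSpace (Submodule ℝ (EuclideanSpace ℝ (Fin n))) :=
  borel _

instance subspaceBorelSpace (n : ℕ) :
    BorelSpace (Submodule ℝ (EuclideanSpace ℝ (Fin n))) :=
  ⟨rfl⟩

/-- The marginal `μ_E` of `μ` on `E`: the push-forward by the orthogonal projection `ℝⁿ → E`. -/
noncomputable def marginalOn {n : ℕ} (μ : Measure (EuclideanSpace ℝ (Fin n)))
    (E : Submodule ℝ (EuclideanSpace ℝ (Fin n))) : Measure E :=
  μ.map E.orthogonalProjectionOnto

/-- `μ` splits along `(E, Eᗮ)`: `μ = μ_E ⊗ μ_{Eᗮ}`, where `E × Eᗮ` is identified with `ℝⁿ`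
through `(y, z) ↦ y + z`. -/
def SplitsAlong {n : ℕ} (μ : Measure (EuclideanSpace ℝ (Fin n)))
    (E : Submodule ℝ (EuclideanSpace ℝ (Fin n))) : Prop :=
  μ = ((marginalOn μ E).prod (marginalOn μ Eᗮ)).map
    (fun p : E × Eᗮ => (p.1 : EuclideanSpace ℝ (Fin n)) + (p.2 : EuclideanSpace ℝ (Fin n)))

/-- `μ` splits with respect to `ξ`: it splits along `(E, Eᗮ)` for `ξ`-almost every `E`. -/
def SplitsWrt {n : ℕ} (μ : Measure (EuclideanSpace ℝ (Fin n)))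
    (ξ : Measure (Submodule ℝ (EuclideanSpace ℝ (Fin n)))) : Prop :=
  ∀ᵐ E ∂ξ, SplitsAlong μ E

/-- The operator inequality `∫ P_E dξ(E) ≤ (1 - lam) id` (Loewner order). -/
def FrameBound {n : ℕ} (ξ : Measure (Submodule ℝ (EuclideanSpace ℝ (Fin n)))) (lam : ℝ) : Prop :=
  ∫ E : Submodule ℝ (EuclideanSpace ℝ (Fin n)), E.starProjection ∂ξ ≤
    (1 - lam) • ContinuousLinearMap.id ℝ (EuclideanSpace ℝ (Fin n))

/-- The σ-algebra on `Ω` generated by the random vector `P_E X`. -/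
noncomputable abbrev sigmaProj {n : ℕ} {Ω : Type*} (X : Ω → EuclideanSpace ℝ (Fin n))
    (E : Submodule ℝ (EuclideanSpace ℝ (Fin n))) : MeasurableSpace Ω :=
  MeasurableSpace.comap (fun ω => E.starProjection (X ω)) inferInstance

/-- `Var(𝔼[f(X) | P_E X])`. -/
noncomputable def varCondExp {n : ℕ} {Ω : Type*} [MeasurableSpace Ω] (P : Measure Ω)
    (X : Ω → EuclideanSpace ℝ (Fin n)) (f : EuclideanSpace ℝ (Fin n) → ℝ)
    (E : Submodule ℝ (EuclideanSpace ℝ (Fin n))) : ℝ :=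
  Var[P[fun ω => f (X ω) | sigmaProj X E]; P]

/-- `𝔼[Var(f(X) | P_E X)]`. -/
noncomputable def expCondVar {n : ℕ} {Ω : Type*} [MeasurableSpace Ω] (P : Measure Ω)
    (X : Ω → EuclideanSpace ℝ (Fin n)) (f : EuclideanSpace ℝ (Fin n) → ℝ)
    (E : Submodule ℝ (EuclideanSpace ℝ (Fin n))) : ℝ :=
  ∫ ω, (Var[fun ω' => f (X ω'); P | sigmaProj X E]) ω ∂P

/-!
Conditioning on `P_E X` is an orthogonal projection of `L²(μ)`, so averaging it over `ξ` gives a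
self-adjoint operator `T`, and the first inequality says that `⟪T f, f⟫ ≤ (1 - lam) ‖f‖²` for
centered `f`. For self-adjoint `T` the sequence `k ↦ ‖T ^ k f‖` is log-convex, so
`‖T ^ k f‖ = O(r ^ k)` already forces `‖T f‖ ≤ r ‖f‖`. The vectors with this decay form a
subspace, hence it is enough that they are dense among the centered functions.

Two kinds of functions decay at rate `1 - lam`. On centered square-integrable linear functionals
`T` acts through `∫ P_E dξ`, whose norm is at most `1 - lam`. If `h` is a test function with
`h dμ` orthogonal to the affine functions, its correlation with `x ↦ f (A x + b)` is `O(‖A‖²)` in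
the Hilbert–Schmidt norm; splitting makes each application of `T` replace `A` by `A P_E`, and on
average `‖A P_E‖² ≤ (1 - lam) ‖A‖²`. Only the constants are orthogonal to all of these functions.
The second inequality is the first one combined with the law of total variance.
-/

section Hilbert

variable {H : Type*} [NormedAddCommGroup H] [InnerProductSpace ℝ H]

theorem inner_pow_apply_left [CompleteSpace H] {T : H →L[ℝ] H} (hT : IsSelfAdjoint T) (k : ℕ)
    (x y : H) : inner ℝ ((T ^ k) x) y = inner ℝ x ((T ^ k) y) :=
  (hT.pow k).isSymmetric x y

theorem norm_pow_succ_apply_sq_le [CompleteSpace H] {T : H →L[ℝ] H} (hT : IsSelfAdjoint T) (k : ℕ)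
    (x : H) : ‖(T ^ (k + 1)) x‖ ^ 2 ≤ ‖(T ^ k) x‖ * ‖(T ^ (k + 2)) x‖ := by
  have hsucc (m : ℕ) : (T ^ (m + 1)) x = T ((T ^ m) x) := by rw [pow_succ']; rfl
  calc ‖(T ^ (k + 1)) x‖ ^ 2
      = inner ℝ ((T ^ k) x) ((T ^ (k + 2)) x) := by
        rw [← real_inner_self_eq_norm_sq, hsucc (k + 1), hsucc k]
        exact hT.isSymmetric _ _
    _ ≤ ‖(T ^ k) x‖ * ‖(T ^ (k + 2)) x‖ := real_inner_le_norm _ _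

theorem norm_apply_mul_norm_pow_apply_le [CompleteSpace H] {T : H →L[ℝ] H} (hT : IsSelfAdjoint T)
    (k : ℕ) (x : H) : ‖T x‖ * ‖(T ^ k) x‖ ≤ ‖x‖ * ‖(T ^ (k + 1)) x‖ := by
  induction k with
  | zero => simp [mul_comm]
  | succ k ih =>
    rcases (norm_nonneg ((T ^ (k + 1)) x)).eq_or_lt with h0 | hpos
    · rw [← h0, mul_zero]
      positivity
    · refine le_of_mul_le_mul_right ?_ hpos
      calc ‖T x‖ * ‖(T ^ (k + 1)) x‖ * ‖(T ^ (k + 1)) x‖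
          = ‖T x‖ * ‖(T ^ (k + 1)) x‖ ^ 2 := by ring
        _ ≤ ‖T x‖ * (‖(T ^ k) x‖ * ‖(T ^ (k + 2)) x‖) := by
            gcongr
            exact norm_pow_succ_apply_sq_le hT k x
        _ = ‖T x‖ * ‖(T ^ k) x‖ * ‖(T ^ (k + 2)) x‖ := by ring
        _ ≤ ‖x‖ * ‖(T ^ (k + 1)) x‖ * ‖(T ^ (k + 2)) x‖ := by gcongr
        _ = ‖x‖ * ‖(T ^ (k + 2)) x‖ * ‖(T ^ (k + 1)) x‖ := by ring

theorem norm_apply_pow_mul_norm_le [CompleteSpace H] {T : H →L[ℝ] H} (hT : IsSelfAdjoint T)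
    (k : ℕ) (x : H) : ‖T x‖ ^ k * ‖x‖ ≤ ‖x‖ ^ k * ‖(T ^ k) x‖ := by
  induction k with
  | zero => simp
  | succ k ih =>
    calc ‖T x‖ ^ (k + 1) * ‖x‖
        = ‖T x‖ * (‖T x‖ ^ k * ‖x‖) := by ring
      _ ≤ ‖T x‖ * (‖x‖ ^ k * ‖(T ^ k) x‖) := by gcongr
      _ = ‖x‖ ^ k * (‖T x‖ * ‖(T ^ k) x‖) := by ring
      _ ≤ ‖x‖ ^ k * (‖x‖ * ‖(T ^ (k + 1)) x‖) := by
          gcongr ‖x‖ ^ k * ?_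
          exact norm_apply_mul_norm_pow_apply_le hT k x
      _ = ‖x‖ ^ (k + 1) * ‖(T ^ (k + 1)) x‖ := by ring

/-- The vectors whose iterates under `T` decay at least like `r ^ k`. For self-adjoint `T` these
are the vectors on which `T` contracts by the factor `r`, see `norm_apply_le_of_mem_geometricDecay`.
-/
def geometricDecay (T : H →L[ℝ] H) (r : ℝ) : Submodule ℝ H where
  carrier := {x | ∃ A, ∀ k : ℕ, ‖(T ^ k) x‖ ≤ A * r ^ k}
  zero_mem' := ⟨0, by simp⟩
  add_mem' := by
    rintro x y ⟨A, hA⟩ ⟨B, hB⟩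
    refine ⟨A + B, fun k => ?_⟩
    rw [map_add, add_mul]
    exact norm_add_le_of_le (hA k) (hB k)
  smul_mem' := by
    rintro c x ⟨A, hA⟩
    refine ⟨|c| * A, fun k => ?_⟩
    rw [map_smul, norm_smul, mul_assoc, Real.norm_eq_abs]
    gcongr
    exact hA k

theorem norm_apply_le_of_mem_geometricDecay [CompleteSpace H] {T : H →L[ℝ] H}
    (hT : IsSelfAdjoint T) {r : ℝ} (hr : 0 ≤ r) {x : H} (hx : x ∈ geometricDecay T r) :
    ‖T x‖ ≤ r * ‖x‖ := by
  obtain ⟨A, hA⟩ := hx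
  rcases eq_or_ne x 0 with rfl | hx0
  · simp
  have hpos : 0 < ‖x‖ := norm_pos_iff.2 hx0
  by_contra! hlt
  have hlittle := isLittleO_pow_pow_of_lt_left (by positivity : 0 ≤ r * ‖x‖) hlt
  have hbig : (fun k => ‖T x‖ ^ k) =O[Filter.atTop] fun k : ℕ => (r * ‖x‖) ^ k := by
    refine Asymptotics.IsBigO.of_bound (A / ‖x‖) (.of_forall fun k => ?_)
    rw [Real.norm_of_nonneg (by positivity), Real.norm_of_nonneg (by positivity),
      div_mul_eq_mul_div, le_div_iff₀ hpos]
    calc ‖T x‖ ^ k * ‖x‖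
        ≤ ‖x‖ ^ k * ‖(T ^ k) x‖ := norm_apply_pow_mul_norm_le hT k x
      _ ≤ ‖x‖ ^ k * (A * r ^ k) := by
          gcongr
          exact hA k
      _ = A * (r * ‖x‖) ^ k := by rw [mul_pow]; ring
  have hTx : 0 < ‖T x‖ := lt_of_le_of_lt (by positivity) hlt
  refine (hbig.trans_isLittleO hlittle).not_isBigO ?_ (Asymptotics.isBigO_refl _ _)
  exact .of_forall fun k => (pow_pos hTx k).ne'

theorem norm_apply_le_of_mem_closure_geometricDecay [CompleteSpace H] {T : H →L[ℝ] H}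
    (hT : IsSelfAdjoint T) {r : ℝ} (hr : 0 ≤ r) {x : H}
    (hx : x ∈ (geometricDecay T r).topologicalClosure) : ‖T x‖ ≤ r * ‖x‖ := by
  have hclosed : IsClosed {y : H | ‖T y‖ ≤ r * ‖y‖} :=
    isClosed_le (by fun_prop) (by fun_prop)
  exact closure_minimal (fun y hy => norm_apply_le_of_mem_geometricDecay hT hr hy) hclosed hx

theorem mem_geometricDecay_of_intertwines {F : Type*} [NormedAddCommGroup F] [NormedSpace ℝ F]
    {T : H →L[ℝ] H} {B : F →L[ℝ] F} {L : F →L[ℝ] H} (hL : T ∘L L = L ∘L B) {r : ℝ}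
    (hr : 0 ≤ r) (hB : ∀ w, ‖B w‖ ≤ r * ‖w‖) (w : F) : L w ∈ geometricDecay T r := by
  have hpow (k : ℕ) : (T ^ k) (L w) = L ((B ^ k) w) := by
    induction k with
    | zero => simp
    | succ k ih =>
      rw [pow_succ', pow_succ']
      exact (congrArg T ih).trans (DFunLike.congr_fun hL _)
  have hdecay (k : ℕ) : ‖(B ^ k) w‖ ≤ r ^ k * ‖w‖ := by
    induction k with
    | zero => simp
    | succ k ih =>
      calc ‖(B ^ (k + 1)) w‖
          = ‖B ((B ^ k) w)‖ := by rw [pow_succ']; rfl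
        _ ≤ r * (r ^ k * ‖w‖) := (hB _).trans (by gcongr)
        _ = r ^ (k + 1) * ‖w‖ := by ring
  refine ⟨‖L‖ * ‖w‖, fun k => ?_⟩
  calc ‖(T ^ k) (L w)‖
      = ‖L ((B ^ k) w)‖ := by rw [hpow]
    _ ≤ ‖L‖ * (r ^ k * ‖w‖) := L.le_of_opNorm_le_of_le le_rfl (hdecay k)
    _ = ‖L‖ * ‖w‖ * r ^ k := by ring

theorem mem_geometricDecay_of_inner_le [CompleteSpace H] {T : H →L[ℝ] H} (hT : IsSelfAdjoint T)
    {r : ℝ} (hr : 0 ≤ r) {x : H} {C : ℝ} (h : ∀ k : ℕ, inner ℝ ((T ^ k) x) x ≤ C * r ^ k) :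
    x ∈ geometricDecay T r := by
  refine ⟨√C, fun k => ?_⟩
  have hsq : ‖(T ^ k) x‖ ^ 2 ≤ C * (r ^ k) ^ 2 :=
    calc ‖(T ^ k) x‖ ^ 2
        = inner ℝ ((T ^ (k + k)) x) x := by
          rw [← real_inner_self_eq_norm_sq, ← inner_pow_apply_left hT, pow_add]
          rfl
      _ ≤ C * (r ^ k) ^ 2 := by
          rw [← pow_mul, mul_two]
          exact h (k + k)
  calc ‖(T ^ k) x‖
      ≤ √(C * (r ^ k) ^ 2) := Real.le_sqrt_of_sq_le hsq
    _ = √C * r ^ k := by rw [Real.sqrt_mul' _ (by positivity), Real.sqrt_sq (by positivity)]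

theorem norm_apply_le_of_isPositive {T : H →L[ℝ] H} (hT : T.IsPositive) {r : ℝ} (hr : 0 ≤ r)
    (h : ∀ x, inner ℝ (T x) x ≤ r * ‖x‖ ^ 2) (x : H) : ‖T x‖ ≤ r * ‖x‖ := by
  let B : LinearMap.BilinForm ℝ H := innerₗ H ∘ₗ T.toLinearMap
  have cauchySchwarz : ‖T x‖ ^ 2 * ‖T x‖ ^ 2 ≤ inner ℝ (T x) x * inner ℝ (T (T x)) (T x) := by
    have hBx := B.apply_mul_apply_le_of_forall_zero_le hT.inner_nonneg_left x (T x)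
    change inner ℝ (T x) (T x) * inner ℝ (T (T x)) x ≤ _ at hBx
    rwa [hT.isSymmetric.apply_clm (T x) x, real_inner_self_eq_norm_sq] at hBx
  have hfour : (‖T x‖ ^ 2) * ‖T x‖ ^ 2 ≤ (r * ‖x‖) ^ 2 * ‖T x‖ ^ 2 :=
    calc ‖T x‖ ^ 2 * ‖T x‖ ^ 2
        ≤ inner ℝ (T x) x * inner ℝ (T (T x)) (T x) := cauchySchwarz
      _ ≤ (r * ‖x‖ ^ 2) * (r * ‖T x‖ ^ 2) :=
          mul_le_mul (h x) (h (T x)) (hT.inner_nonneg_left _) (by positivity)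
      _ = (r * ‖x‖) ^ 2 * ‖T x‖ ^ 2 := by ring
  rcases (norm_nonneg (T x)).eq_or_lt with h0 | hpos
  · rw [← h0]
    positivity
  · exact abs_le_of_sq_le_sq' (le_of_mul_le_mul_right hfour (by positivity)) (by positivity) |>.2

end Hilbert

section Independence

theorem condExp_comp_ae_eq {Ω S G : Type*} [mΩ : MeasurableSpace Ω] {m mS : MeasurableSpace S}
    [NormedAddCommGroup G] [NormedSpace ℝ G] [CompleteSpace G] {P : Measure Ω}
    [IsFiniteMeasure P] {X : Ω → S} (hX : Measurable X) (hm : m ≤ mS) {f : S → G}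
    (hf : Integrable f (P.map X)) :
    P[fun ω => f (X ω) | m.comap X] =ᵐ[P] fun ω => ((P.map X)[f | m]) (X ω) := by
  have hle : m.comap X ≤ mΩ := (MeasurableSpace.comap_mono hm).trans hX.comap_le
  symm
  refine ae_eq_condExp_of_forall_setIntegral_eq hle (hf.comp_measurable hX)
    (fun s _ _ => (integrable_condExp.comp_measurable hX).integrableOn) ?_
    (stronglyMeasurable_condExp.comp_measurable (comap_measurable X)).aestronglyMeasurable
  rintro s ⟨t, ht, rfl⟩ _
  rw [← setIntegral_map (hm t ht) integrable_condExp.aestronglyMeasurable hX.aemeasurable,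
    ← setIntegral_map (hm t ht) hf.aestronglyMeasurable hX.aemeasurable,
    setIntegral_condExp hm hf ht]

theorem condExp_comp_prodMk_of_indepFun {Ω α β G : Type*} [MeasurableSpace Ω]
    [mα : MeasurableSpace α] [MeasurableSpace β] [StandardBorelSpace β] [Nonempty β]
    [NormedAddCommGroup G] [NormedSpace ℝ G] [CompleteSpace G]
    {P : Measure Ω} [IsFiniteMeasure P] {A : Ω → α} {B : Ω → β} (hA : Measurable A)
    (hB : Measurable B) (hAB : IndepFun A B P) {g : α × β → G}
    (hg : Integrable g (P.map fun ω => (A ω, B ω))) :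
    P[fun ω => g (A ω, B ω) | mα.comap A] =ᵐ[P] fun ω => ∫ ω', g (A ω, B ω') ∂P := by
  have hprod := (indepFun_iff_map_prod_eq_prod_map_map hA.aemeasurable hB.aemeasurable).1 hAB
  have hconst : condDistrib B A P =ᵐ[P.map A] Kernel.const α (P.map B) := by
    rw [condDistrib_ae_eq_iff_measure_eq_compProd A hB.aemeasurable, Measure.compProd_const, hprod]
  have hslice : ∀ᵐ a ∂P.map A, AEStronglyMeasurable (fun b => g (a, b)) (P.map B) :=
    (hprod ▸ hg.aestronglyMeasurable).prodMk_left
  filter_upwards [condExp_prod_ae_eq_integral_condDistrib' hA hB.aemeasurable hg,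
    ae_of_ae_map hA.aemeasurable hconst, ae_of_ae_map hA.aemeasurable hslice]
    with ω hcond hωconst hωslice
  rw [hcond, hωconst, Kernel.const_apply, integral_map hB.aemeasurable hωslice]

end Independence

section MixProj

variable {F : Type*} [NormedAddCommGroup F] [InnerProductSpace ℝ F]

/-- The vector whose `E`-component is that of `x` and whose `Eᗮ`-component is that of `y`. If `μ`
splits along `(E, Eᗮ)` and `x`, `y` are independent with law `μ`, it has law `μ` again. -/
noncomputable def mixProj (E : Submodule ℝ F) [E.HasOrthogonalProjection] (x y : F) : F :=
  E.starProjection x + Eᗮ.starProjection y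

theorem inner_mixProj (E : Submodule ℝ F) [E.HasOrthogonalProjection] (u x y : F) :
    inner ℝ u (mixProj E x y)
      = inner ℝ (E.starProjection u) x + inner ℝ (Eᗮ.starProjection u) y := by
  rw [mixProj, inner_add_right, E.inner_starProjection_left_eq_right,
    Eᗮ.inner_starProjection_left_eq_right]

theorem starProjection_mixProj (E : Submodule ℝ F) [E.HasOrthogonalProjection] (x y : F) :
    E.starProjection (mixProj E x y) = E.starProjection x := by
  rw [mixProj, map_add, E.starProjection_apply_eq_zero_iff.2 (Eᗮ.starProjection_apply_mem y),
    add_zero, Submodule.starProjection_eq_self_iff.2 (E.starProjection_apply_mem x)]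

theorem starProjection_orthogonal_mixProj (E : Submodule ℝ F) [E.HasOrthogonalProjection]
    (x y : F) : Eᗮ.starProjection (mixProj E x y) = Eᗮ.starProjection y := by
  have hE : E.starProjection x ∈ Eᗮᗮ := E.le_orthogonal_orthogonal (E.starProjection_apply_mem x)
  rw [mixProj, map_add, Eᗮ.starProjection_apply_eq_zero_iff.2 hE, zero_add,
    Submodule.starProjection_eq_self_iff.2 (Eᗮ.starProjection_apply_mem y)]

end MixProj

section Grassmannian

variable {n : ℕ}

theorem continuous_starProjection :
    Continuous (fun E : Submodule ℝ (EuclideanSpace ℝ (Fin n)) => E.starProjection) :=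
  continuous_induced_dom

instance secondCountableTopology_submodule :
    SecondCountableTopology (Submodule ℝ (EuclideanSpace ℝ (Fin n))) :=
  TopologicalSpace.secondCountableTopology_induced _ _ _

theorem measurable_mixProj :
    Measurable (fun p : Submodule ℝ (EuclideanSpace ℝ (Fin n)) × EuclideanSpace ℝ (Fin n) ×
      EuclideanSpace ℝ (Fin n) => mixProj p.1 p.2.1 p.2.2) := by
  have hP : Continuous fun p : Submodule ℝ (EuclideanSpace ℝ (Fin n)) × EuclideanSpace ℝ (Fin n) ×
      EuclideanSpace ℝ (Fin n) => p.1.starProjection :=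
    continuous_starProjection.comp continuous_fst
  refine Continuous.measurable ?_
  simp only [mixProj, Submodule.starProjection_orthogonal]
  fun_prop

end Grassmannian

section Splitting

variable {n : ℕ} {μ : Measure (EuclideanSpace ℝ (Fin n))}
  {E : Submodule ℝ (EuclideanSpace ℝ (Fin n))}

theorem SplitsAlong.measurePreserving_mixProj [SFinite μ] (h : SplitsAlong μ E) :
    MeasurePreserving (fun p : EuclideanSpace ℝ (Fin n) × EuclideanSpace ℝ (Fin n) =>
      mixProj E p.1 p.2) (μ.prod μ) μ := by
  refine ⟨by unfold mixProj; fun_prop, ?_⟩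
  unfold SplitsAlong marginalOn at h
  rw [Measure.map_prod_map _ _ (by fun_prop) (by fun_prop), Measure.map_map (by fun_prop)
    (by fun_prop)] at h
  exact h.symm

theorem SplitsAlong.indepFun [IsProbabilityMeasure μ] (h : SplitsAlong μ E) :
    IndepFun E.starProjection Eᗮ.starProjection μ := by
  rw [indepFun_iff_map_prod_eq_prod_map_map (by fun_prop) (by fun_prop),
    Measure.map_prod_map _ _ (by fun_prop) (by fun_prop)]
  conv_lhs => rw [← h.measurePreserving_mixProj.map_eq]
  rw [Measure.map_map (by fun_prop) h.measurePreserving_mixProj.measurable]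
  congr 1
  ext1 p
  exact Prod.ext (starProjection_mixProj E p.1 p.2) (starProjection_orthogonal_mixProj E p.1 p.2)

theorem SplitsAlong.condExp_ae_eq [IsProbabilityMeasure μ] (h : SplitsAlong μ E)
    {f : EuclideanSpace ℝ (Fin n) → ℝ} (hf : Integrable f μ) :
    μ[f | sigmaProj id E] =ᵐ[μ] fun x => ∫ y, f (mixProj E x y) ∂μ := by
  have hadd : MeasurePreserving (fun p : EuclideanSpace ℝ (Fin n) × EuclideanSpace ℝ (Fin n) =>
      p.1 + p.2) (μ.map fun x => (E.starProjection x, Eᗮ.starProjection x)) μ := by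
    refine ⟨by fun_prop, ?_⟩
    rw [Measure.map_map (by fun_prop) (by fun_prop)]
    simp only [Function.comp_def, E.starProjection_add_starProjection_orthogonal]
    exact Measure.map_id
  have hcond := condExp_comp_prodMk_of_indepFun (by fun_prop) (by fun_prop) h.indepFun
    (hadd.integrable_comp_of_integrable hf)
  simp only [Function.comp_def, E.starProjection_add_starProjection_orthogonal] at hcond
  exact hcond

end Splitting

section Operators

theorem measurePreserving_fst_snd {α β γ : Type*} [MeasurableSpace α] [MeasurableSpace β]
    [MeasurableSpace γ] {κ : Measure α} {μ : Measure β} {ν : Measure γ} [IsProbabilityMeasure κ]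
    [SFinite μ] [IsProbabilityMeasure ν] :
    MeasurePreserving (fun p : α × β × γ => p.2.1) (κ.prod (μ.prod ν)) μ :=
  measurePreserving_fst.comp measurePreserving_snd

variable {n : ℕ} {μ : Measure (EuclideanSpace ℝ (Fin n))}

theorem sigmaProj_id_le (E : Submodule ℝ (EuclideanSpace ℝ (Fin n))) :
    sigmaProj id E ≤ (inferInstance : MeasurableSpace (EuclideanSpace ℝ (Fin n))) :=
  Measurable.comap_le (by fun_prop)

/-- The conditional expectation given `P_E`, as an operator on `L²(μ)`. -/
noncomputable def condProj (μ : Measure (EuclideanSpace ℝ (Fin n)))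
    (E : Submodule ℝ (EuclideanSpace ℝ (Fin n))) : Lp ℝ 2 μ →L[ℝ] Lp ℝ 2 μ :=
  (lpMeas ℝ ℝ (sigmaProj id E) 2 μ).subtypeL ∘L condExpL2 ℝ ℝ (sigmaProj_id_le E)

theorem inner_condProj_left (E : Submodule ℝ (EuclideanSpace ℝ (Fin n))) (f g : Lp ℝ 2 μ) :
    inner ℝ (condProj μ E f) g = inner ℝ f (condProj μ E g) :=
  inner_condExpL2_left_eq_right (𝕜 := ℝ) (sigmaProj_id_le E)

theorem inner_condProj_self (E : Submodule ℝ (EuclideanSpace ℝ (Fin n))) (f : Lp ℝ 2 μ) :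
    inner ℝ (condProj μ E f) f = ‖condProj μ E f‖ ^ 2 := by
  rw [← real_inner_self_eq_norm_sq, real_inner_comm]
  exact (inner_condExpL2_eq_inner_fun (𝕜 := ℝ) (sigmaProj_id_le E) f (condProj μ E f)
    (aestronglyMeasurable_condExpL2 (𝕜 := ℝ) (sigmaProj_id_le E) f)).symm

theorem condProj_ae_eq [IsFiniteMeasure μ] (E : Submodule ℝ (EuclideanSpace ℝ (Fin n)))
    (f : Lp ℝ 2 μ) : condProj μ E f =ᵐ[μ] μ[f | sigmaProj id E] := by
  have h := (Lp.memLp f).condExpL2_ae_eq_condExp (𝕜 := ℝ) (sigmaProj_id_le E)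
  rwa [Lp.toLp_coeFn] at h

variable [IsProbabilityMeasure μ]

theorem SplitsAlong.condProj_ae_eq {E : Submodule ℝ (EuclideanSpace ℝ (Fin n))}
    (h : SplitsAlong μ E) (f : Lp ℝ 2 μ) :
    condProj μ E f =ᵐ[μ] fun x => ∫ y, f (mixProj E x y) ∂μ :=
  (_root_.condProj_ae_eq E f).trans (h.condExp_ae_eq ((Lp.memLp f).integrable one_le_two))

theorem SplitsAlong.inner_condProj {E : Submodule ℝ (EuclideanSpace ℝ (Fin n))}
    (h : SplitsAlong μ E) (f g : Lp ℝ 2 μ) :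
    inner ℝ (condProj μ E f) g = ∫ p, f (mixProj E p.1 p.2) * g p.1 ∂(μ.prod μ) := by
  have hmix := (Lp.memLp f).comp_measurePreserving h.measurePreserving_mixProj
  have hfst := (Lp.memLp g).comp_measurePreserving (measurePreserving_fst (μ := μ) (ν := μ))
  refine Eq.trans ?_ (integral_prod _ (hmix.integrable_mul hfst)).symm
  refine (L2.inner_def _ _).trans (integral_congr_ae ?_)
  filter_upwards [h.condProj_ae_eq f] with x hx
  simp only [Pi.mul_apply, Function.comp_apply]
  rw [integral_mul_const, hx]
  exact mul_comm _ _

variable {ξ : Measure (Submodule ℝ (EuclideanSpace ℝ (Fin n)))}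

theorem SplitsWrt.integral_mixProj_mul_ae_eq (h : SplitsWrt μ ξ) (f g : Lp ℝ 2 μ) :
    (fun E => ∫ p, f (mixProj E p.1 p.2) * g p.1 ∂(μ.prod μ)) =ᵐ[ξ]
      fun E => inner ℝ (condProj μ E f) g := by
  filter_upwards [h] with E hE using (hE.inner_condProj f g).symm

variable [IsProbabilityMeasure ξ]

theorem SplitsWrt.measurePreserving_mixProj (h : SplitsWrt μ ξ) :
    MeasurePreserving (fun p : Submodule ℝ (EuclideanSpace ℝ (Fin n)) ×
      EuclideanSpace ℝ (Fin n) × EuclideanSpace ℝ (Fin n) => mixProj p.1 p.2.1 p.2.2)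
      (ξ.prod (μ.prod μ)) μ := by
  refine ⟨measurable_mixProj, Measure.ext fun s hs => ?_⟩
  rw [Measure.map_apply measurable_mixProj hs, Measure.prod_apply (measurable_mixProj hs)]
  have hslice : ∀ᵐ E ∂ξ, (μ.prod μ) {p | mixProj E p.1 p.2 ∈ s} = μ s :=
    h.mono fun _ hE => hE.measurePreserving_mixProj.measure_preimage hs.nullMeasurableSet
  exact (lintegral_congr_ae hslice).trans (by simp)

/-- The operator `f ↦ ∫ 𝔼[f | P_E] dξ(E)` on `L²(μ)`, encoded as `U† V` where `U` and `V` are the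
isometric embeddings of `L²(μ)` in `L²(ξ ⊗ μ ⊗ μ)` along `(E, x, y) ↦ x` and
`(E, x, y) ↦ P_E x + P_{Eᗮ} y`. This avoids integrating an operator-valued function. -/
noncomputable def averageCondProj (h : SplitsWrt μ ξ) : Lp ℝ 2 μ →L[ℝ] Lp ℝ 2 μ :=
  (Lp.compMeasurePreservingₗᵢ ℝ _
      (measurePreserving_fst_snd (κ := ξ) (μ := μ) (ν := μ))).toContinuousLinearMap.adjoint ∘L
    (Lp.compMeasurePreservingₗᵢ ℝ _ h.measurePreserving_mixProj).toContinuousLinearMap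

theorem SplitsWrt.integrable_mixProj_mul (h : SplitsWrt μ ξ) (f g : Lp ℝ 2 μ) :
    Integrable (fun p : Submodule ℝ (EuclideanSpace ℝ (Fin n)) ×
      EuclideanSpace ℝ (Fin n) × EuclideanSpace ℝ (Fin n) =>
        f (mixProj p.1 p.2.1 p.2.2) * g p.2.1) (ξ.prod (μ.prod μ)) :=
  ((Lp.memLp f).comp_measurePreserving h.measurePreserving_mixProj).integrable_mul <|
    (Lp.memLp g).comp_measurePreserving measurePreserving_fst_snd

theorem SplitsWrt.integrable_inner_condProj (h : SplitsWrt μ ξ) (f g : Lp ℝ 2 μ) :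
    Integrable (fun E => inner ℝ (condProj μ E f) g) ξ :=
  (h.integrable_mixProj_mul f g).integral_prod_left.congr (h.integral_mixProj_mul_ae_eq f g)

theorem inner_averageCondProj (h : SplitsWrt μ ξ) (f g : Lp ℝ 2 μ) :
    inner ℝ (averageCondProj h f) g = ∫ E, inner ℝ (condProj μ E f) g ∂ξ := by
  rw [← integral_congr_ae (h.integral_mixProj_mul_ae_eq f g),
    ← integral_prod _ (h.integrable_mixProj_mul f g), averageCondProj,
    ContinuousLinearMap.comp_apply, ContinuousLinearMap.adjoint_inner_left, L2.inner_def]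
  refine integral_congr_ae ?_
  filter_upwards [Lp.coeFn_compMeasurePreserving f h.measurePreserving_mixProj,
    Lp.coeFn_compMeasurePreserving g measurePreserving_fst_snd] with p hf hg
  exact (congrArg₂ (inner ℝ) hf hg).trans (mul_comm _ _)

theorem isSelfAdjoint_averageCondProj (h : SplitsWrt μ ξ) : IsSelfAdjoint (averageCondProj h) := by
  refine ContinuousLinearMap.isSelfAdjoint_iff_isSymmetric.2 fun f g => ?_
  calc inner ℝ (averageCondProj h f) g
      = ∫ E, inner ℝ (condProj μ E f) g ∂ξ := inner_averageCondProj h f g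
    _ = ∫ E, inner ℝ (condProj μ E g) f ∂ξ := by
        simp only [inner_condProj_left _ f g, real_inner_comm f]
    _ = inner ℝ f (averageCondProj h g) := by rw [real_inner_comm, inner_averageCondProj]

end Operators

section Frame

variable {n : ℕ} {ξ : Measure (Submodule ℝ (EuclideanSpace ℝ (Fin n)))} [IsProbabilityMeasure ξ]

theorem integrable_starProjection :
    Integrable (fun E : Submodule ℝ (EuclideanSpace ℝ (Fin n)) => E.starProjection) ξ :=
  .of_bound continuous_starProjection.aestronglyMeasurable 1
    (.of_forall fun E => E.starProjection_norm_le)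

theorem inner_integral_starProjection (u w : EuclideanSpace ℝ (Fin n)) :
    inner ℝ ((∫ E : Submodule ℝ (EuclideanSpace ℝ (Fin n)), E.starProjection ∂ξ) u) w
      = ∫ E : Submodule ℝ (EuclideanSpace ℝ (Fin n)), inner ℝ (E.starProjection u) w ∂ξ := by
  rw [ContinuousLinearMap.integral_apply integrable_starProjection, real_inner_comm,
    ← integral_inner (integrable_starProjection.apply_continuousLinearMap u)]
  simp only [real_inner_comm]

theorem inner_integral_starProjection_self (u : EuclideanSpace ℝ (Fin n)) :
    inner ℝ ((∫ E : Submodule ℝ (EuclideanSpace ℝ (Fin n)), E.starProjection ∂ξ) u) u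
      = ∫ E : Submodule ℝ (EuclideanSpace ℝ (Fin n)), ‖E.starProjection u‖ ^ 2 ∂ξ := by
  rw [inner_integral_starProjection]
  exact integral_congr_ae (.of_forall fun E => E.re_inner_starProjection_eq_normSq u)

theorem isPositive_integral_starProjection :
    (∫ E : Submodule ℝ (EuclideanSpace ℝ (Fin n)), E.starProjection ∂ξ).IsPositive := by
  refine (ContinuousLinearMap.isPositive_iff _).2 ⟨fun u w => ?_, fun u => ?_⟩
  · calc inner ℝ ((∫ E : Submodule ℝ (EuclideanSpace ℝ (Fin n)), E.starProjection ∂ξ) u) w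
        = ∫ E : Submodule ℝ (EuclideanSpace ℝ (Fin n)), inner ℝ u (E.starProjection w) ∂ξ := by
          simp only [inner_integral_starProjection, Submodule.inner_starProjection_left_eq_right]
      _ = inner ℝ u ((∫ E : Submodule ℝ (EuclideanSpace ℝ (Fin n)), E.starProjection ∂ξ) w) := by
          rw [real_inner_comm, inner_integral_starProjection]
          simp only [real_inner_comm]
  · rw [inner_integral_starProjection_self]
    positivity

variable {lam : ℝ}

theorem FrameBound.integral_norm_sq_le (h : FrameBound ξ lam) (u : EuclideanSpace ℝ (Fin n)) :
    ∫ E : Submodule ℝ (EuclideanSpace ℝ (Fin n)), ‖E.starProjection u‖ ^ 2 ∂ξ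
      ≤ (1 - lam) * ‖u‖ ^ 2 := by
  have hpos := ((ContinuousLinearMap.le_def _ _).1 h).inner_nonneg_left u
  simp only [_root_.sub_apply, _root_.smul_apply, ContinuousLinearMap.id_apply, inner_sub_left,
    real_inner_smul_left, real_inner_self_eq_norm_sq, inner_integral_starProjection_self] at hpos
  linarith

theorem FrameBound.norm_integral_apply_le (h : FrameBound ξ lam) (hr : 0 ≤ 1 - lam)
    (u : EuclideanSpace ℝ (Fin n)) :
    ‖(∫ E : Submodule ℝ (EuclideanSpace ℝ (Fin n)), E.starProjection ∂ξ) u‖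
      ≤ (1 - lam) * ‖u‖ :=
  norm_apply_le_of_isPositive isPositive_integral_starProjection hr
    (fun u => (inner_integral_starProjection_self u).trans_le (h.integral_norm_sq_le u)) u

end Frame

section TestFunctions

open TopologicalSpace (Opens)
open scoped Distributions NNReal

theorem inner_toLp_eq_integral {α : Type*} [MeasurableSpace α] {ν : Measure α} (h : Lp ℝ 2 ν)
    {f : α → ℝ} (hf : MemLp f 2 ν) : inner ℝ h (hf.toLp f) = ∫ x, h x * f x ∂ν := by
  refine (L2.inner_def _ _).trans (integral_congr_ae ?_)
  filter_upwards [hf.coeFn_toLp] with x hx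
  rw [hx]
  exact mul_comm _ _

theorem exists_norm_sub_sub_fderiv_le {F G : Type*} [NormedAddCommGroup F] [NormedSpace ℝ F]
    [NormedAddCommGroup G] [NormedSpace ℝ G] {f : F → G} (hf : ContDiff ℝ 2 f)
    (hfc : HasCompactSupport f) :
    ∃ M : ℝ≥0, ∀ x v, ‖f (x + v) - f x - fderiv ℝ f x v‖ ≤ M * ‖v‖ ^ 2 := by
  obtain ⟨M, hM⟩ := (hf.fderiv_right (m := 1) le_rfl).lipschitzWith_of_hasCompactSupport
    (hfc.fderiv ℝ) one_ne_zero
  refine ⟨M, fun x v => ?_⟩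
  have hbound (z : F) (hz : z ∈ segment ℝ x (x + v)) :
      ‖fderiv ℝ f z - fderiv ℝ f x‖ ≤ M * ‖v‖ := by
    refine (hM.norm_sub_le z x).trans ?_
    gcongr
    simpa using norm_sub_le_of_mem_segment hz
  have hmean := (convex_segment x (x + v)).norm_image_sub_le_of_norm_fderiv_le'
    (fun z _ => hf.differentiable two_ne_zero z) hbound (left_mem_segment ℝ x (x + v))
    (right_mem_segment ℝ x (x + v))
  rw [add_sub_cancel_left, mul_assoc, ← pow_two] at hmean
  exact hmean

variable {F : Type*} [NormedAddCommGroup F] [NormedSpace ℝ F] [MeasurableSpace F] [BorelSpace F]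
  {μ : Measure F}

/-- `f` is orthogonal to every affine function in `L²(μ)`. -/
def AffineFree (μ : Measure F) (f : F → ℝ) : Prop :=
  ∀ (c : ℝ) (ℓ : F →L[ℝ] ℝ), ∫ x, f x * (c + ℓ x) ∂μ = 0

/-- The distribution on `F` with `μ`-density `w`, for a locally `μ`-integrable `w`. -/
noncomputable def testPairing (μ : Measure F) (w : F → ℝ) :
    𝓓((⊤ : Opens F), ℝ) →ₗ[ℝ] ℝ :=
  (TestFunction.integralAgainstBilinCLM (ContinuousLinearMap.mul ℝ ℝ) μ w).toLinearMap

theorem testPairing_apply {w : F → ℝ} (hw : LocallyIntegrable w μ) (g : 𝓓((⊤ : Opens F), ℝ)) :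
    testPairing μ w g = ∫ x, g x * w x ∂μ :=
  TestFunction.integralAgainstBilinCLM_eq_integral (hw.locallyIntegrableOn _)

theorem ae_eq_of_testPairing_eq [FiniteDimensional ℝ F] {w w' : F → ℝ}
    (hw : LocallyIntegrable w μ) (hw' : LocallyIntegrable w' μ)
    (h : testPairing μ w = testPairing μ w') : w =ᵐ[μ] w' := by
  refine ae_eq_of_integral_contDiff_smul_eq hw hw' fun g hg hgc => ?_
  have hg' := DFunLike.congr_fun h ⟨g, hg, hgc, Set.subset_univ _⟩
  rwa [testPairing_apply hw, testPairing_apply hw'] at hg'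

theorem locallyIntegrable_affine [IsLocallyFiniteMeasure μ] (c : ℝ) (ℓ : F →L[ℝ] ℝ) :
    LocallyIntegrable (fun x => c + ℓ x) μ :=
  Continuous.locallyIntegrable (by fun_prop)

theorem integrable_testFunction_mul {w : F → ℝ} (hw : LocallyIntegrable w μ)
    (g : 𝓓((⊤ : Opens F), ℝ)) : Integrable (fun x => g x * w x) μ :=
  TestFunction.integrable_bilin (ContinuousLinearMap.mul ℝ ℝ) (hw.locallyIntegrableOn _) g

/-- The affine function `c + ℓ`, regarded as a distribution on `F`, linearly in `(c, ℓ)`. -/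
noncomputable def affinePairing (μ : Measure F) [IsLocallyFiniteMeasure μ] :
    (ℝ × (F →L[ℝ] ℝ)) →ₗ[ℝ] 𝓓((⊤ : Opens F), ℝ) →ₗ[ℝ] ℝ where
  toFun p := testPairing μ fun x => p.1 + p.2 x
  map_add' p q := by
    ext g
    have hp := locallyIntegrable_affine (μ := μ) p.1 p.2
    have hq := locallyIntegrable_affine (μ := μ) q.1 q.2
    rw [LinearMap.add_apply, testPairing_apply hp, testPairing_apply hq,
      testPairing_apply (locallyIntegrable_affine _ _),
      ← integral_add (integrable_testFunction_mul hp g) (integrable_testFunction_mul hq g)]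
    refine integral_congr_ae (.of_forall fun x => ?_)
    simp only [Prod.fst_add, Prod.snd_add, _root_.add_apply]
    ring
  map_smul' a p := by
    ext g
    rw [RingHom.id_apply, LinearMap.smul_apply, smul_eq_mul,
      testPairing_apply (locallyIntegrable_affine _ _),
      testPairing_apply (locallyIntegrable_affine _ _), ← integral_const_mul]
    refine integral_congr_ae (.of_forall fun x => ?_)
    simp only [Prod.smul_fst, Prod.smul_snd, _root_.smul_apply, smul_eq_mul]
    ring

theorem ae_eq_affine_of_integral_testFunction_eq_zero [FiniteDimensional ℝ F]
    [IsLocallyFiniteMeasure μ] {h : F → ℝ} (hh : LocallyIntegrable h μ)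
    (hint : ∀ g : 𝓓((⊤ : Opens F), ℝ), AffineFree μ g → ∫ x, g x * h x ∂μ = 0) :
    ∃ (c : ℝ) (ℓ : F →L[ℝ] ℝ), h =ᵐ[μ] fun x => c + ℓ x := by
  have hmem : testPairing μ h ∈
      (LinearMap.range (affinePairing μ)).dualCoannihilator.dualAnnihilator := by
    refine (Submodule.mem_dualAnnihilator _).2 fun g hg => ?_
    rw [testPairing_apply hh]
    refine hint g fun c ℓ => ?_
    rw [← testPairing_apply (locallyIntegrable_affine c ℓ)]
    exact (Submodule.mem_dualCoannihilator _).1 hg _ ⟨(c, ℓ), rfl⟩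
  rw [Subspace.dualCoannihilator_dualAnnihilator_eq] at hmem
  obtain ⟨p, hp⟩ := hmem
  exact ⟨p.1, p.2, ae_eq_of_testPairing_eq hh (locallyIntegrable_affine _ _) hp.symm⟩

end TestFunctions

section HilbertSchmidt

variable {F : Type*} [NormedAddCommGroup F] [InnerProductSpace ℝ F] [FiniteDimensional ℝ F]

/-- The squared Hilbert–Schmidt norm of `A`, as the sum of the squared norms of its rows. -/
noncomputable def hilbertSchmidtSq (A : F →L[ℝ] F) : ℝ :=
  ∑ i, ‖A.adjoint (stdOrthonormalBasis ℝ F i)‖ ^ 2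

theorem norm_apply_sq_le_hilbertSchmidtSq (A : F →L[ℝ] F) (x : F) :
    ‖A x‖ ^ 2 ≤ hilbertSchmidtSq A * ‖x‖ ^ 2 := by
  rw [← (stdOrthonormalBasis ℝ F).sum_sq_norm_inner_right, hilbertSchmidtSq, Finset.sum_mul]
  refine Finset.sum_le_sum fun i _ => ?_
  rw [← ContinuousLinearMap.adjoint_inner_left, ← mul_pow]
  gcongr
  exact norm_inner_le_norm _ _

theorem hilbertSchmidtSq_comp_starProjection (A : F →L[ℝ] F) (E : Submodule ℝ F) :
    hilbertSchmidtSq (A ∘L E.starProjection)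
      = ∑ i, ‖E.starProjection (A.adjoint (stdOrthonormalBasis ℝ F i))‖ ^ 2 := by
  simp only [hilbertSchmidtSq, ContinuousLinearMap.adjoint_comp, ContinuousLinearMap.comp_apply,
    (isSelfAdjoint_starProjection E).adjoint_eq]

end HilbertSchmidt

section HilbertSchmidtAverage

variable {n : ℕ} {ξ : Measure (Submodule ℝ (EuclideanSpace ℝ (Fin n)))} [IsProbabilityMeasure ξ]

theorem integrable_norm_starProjection_sq (u : EuclideanSpace ℝ (Fin n)) :
    Integrable (fun E : Submodule ℝ (EuclideanSpace ℝ (Fin n)) => ‖E.starProjection u‖ ^ 2) ξ :=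
  ((integrable_starProjection.apply_continuousLinearMap u).inner_const u).congr
    (.of_forall fun E => E.re_inner_starProjection_eq_normSq u)

theorem integrable_hilbertSchmidtSq_comp_starProjection
    (A : EuclideanSpace ℝ (Fin n) →L[ℝ] EuclideanSpace ℝ (Fin n)) :
    Integrable (fun E : Submodule ℝ (EuclideanSpace ℝ (Fin n)) =>
      hilbertSchmidtSq (A ∘L E.starProjection)) ξ := by
  simp only [hilbertSchmidtSq_comp_starProjection]
  exact integrable_finsetSum _ fun i _ => integrable_norm_starProjection_sq _

theorem FrameBound.integral_hilbertSchmidtSq_le {lam : ℝ} (h : FrameBound ξ lam)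
    (A : EuclideanSpace ℝ (Fin n) →L[ℝ] EuclideanSpace ℝ (Fin n)) :
    ∫ E : Submodule ℝ (EuclideanSpace ℝ (Fin n)), hilbertSchmidtSq (A ∘L E.starProjection) ∂ξ
      ≤ (1 - lam) * hilbertSchmidtSq A := by
  simp only [hilbertSchmidtSq_comp_starProjection]
  rw [integral_finsetSum _ fun i _ => integrable_norm_starProjection_sq _, hilbertSchmidtSq,
    Finset.mul_sum]
  exact Finset.sum_le_sum fun i _ => h.integral_norm_sq_le _

end HilbertSchmidtAverage

section PullbackBound

open TopologicalSpace (Opens)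
open scoped Distributions BoundedContinuousFunction

variable {F : Type*} [NormedAddCommGroup F] [InnerProductSpace ℝ F] [FiniteDimensional ℝ F]
  [MeasurableSpace F]

/-- The correlation of `h` with the affine pullbacks `x ↦ f (A x + b)` is of second order in `A`,
uniformly in `b`. -/
def PullbackBound (μ : Measure F) (f h : F → ℝ) (K : ℝ) : Prop :=
  ∀ (A : F →L[ℝ] F) (b : F), |∫ x, h x * f (A x + b) ∂μ| ≤ K * hilbertSchmidtSq A

variable [BorelSpace F] {μ : Measure F}

theorem memLp_pullback [IsFiniteMeasure μ] (f : F →ᵇ ℝ) (A : F →L[ℝ] F) (b : F) :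
    MemLp (fun x => f (A x + b)) 2 μ :=
  .of_bound (by fun_prop) ‖f‖ (.of_forall fun _ => f.norm_coe_le_norm _)

theorem exists_pullbackBound [IsFiniteMeasure μ] {f : F → ℝ} (hf : ContDiff ℝ 2 f)
    (hfc : HasCompactSupport f) {h : F → ℝ} (hh : Continuous h) (hhc : HasCompactSupport h)
    (hfree : AffineFree μ h) : ∃ K, 0 ≤ K ∧ PullbackBound μ f h K := by
  obtain ⟨M, hM⟩ := exists_norm_sub_sub_fderiv_le hf hfc
  have hint {w : F → ℝ} (hw : Continuous w) : Integrable (fun x => h x * w x) μ :=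
    (hh.mul hw).integrable_of_hasCompactSupport hhc.mul_right
  refine ⟨M * ∫ x, |h x| * ‖x‖ ^ 2 ∂μ, by positivity, fun A b => ?_⟩
  have htaylor : ∫ x, h x * f (A x + b) ∂μ
      = ∫ x, h x * (f (b + A x) - f b - fderiv ℝ f b (A x)) ∂μ := by
    have hfb : Continuous f := hf.continuous
    rw [← sub_eq_zero, ← integral_sub (hint (by fun_prop)) (hint (by fun_prop)),
      ← hfree (f b) (fderiv ℝ f b ∘L A)]
    refine integral_congr_ae (.of_forall fun x => ?_)
    simp only [add_comm b, ContinuousLinearMap.comp_apply]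
    ring
  calc |∫ x, h x * f (A x + b) ∂μ|
      = ‖∫ x, h x * (f (b + A x) - f b - fderiv ℝ f b (A x)) ∂μ‖ := by
        rw [htaylor, Real.norm_eq_abs]
    _ ≤ ∫ x, M * hilbertSchmidtSq A * (|h x| * ‖x‖ ^ 2) ∂μ := by
        refine norm_integral_le_of_norm_le (.const_mul ?_ _) (.of_forall fun x => ?_)
        · exact (hh.abs.mul (by fun_prop)).integrable_of_hasCompactSupport hhc.abs.mul_right
        · calc ‖h x * (f (b + A x) - f b - fderiv ℝ f b (A x))‖
              ≤ |h x| * (M * ‖A x‖ ^ 2) := by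
                rw [norm_mul, Real.norm_eq_abs (h x)]
                gcongr
                exact hM b (A x)
            _ ≤ |h x| * (M * (hilbertSchmidtSq A * ‖x‖ ^ 2)) := by
                gcongr
                exact norm_apply_sq_le_hilbertSchmidtSq A x
            _ = M * hilbertSchmidtSq A * (|h x| * ‖x‖ ^ 2) := by ring
    _ = M * (∫ x, |h x| * ‖x‖ ^ 2 ∂μ) * hilbertSchmidtSq A := by
        rw [integral_const_mul]
        ring

end PullbackBound

section PullbackAverage

open TopologicalSpace (Opens)
open scoped Distributions BoundedContinuousFunction

variable {n : ℕ} {μ : Measure (EuclideanSpace ℝ (Fin n))} [IsProbabilityMeasure μ]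
  {f : EuclideanSpace ℝ (Fin n) →ᵇ ℝ}

theorem SplitsAlong.integral_condProj_mul_pullback {E : Submodule ℝ (EuclideanSpace ℝ (Fin n))}
    (hE : SplitsAlong μ E) (f : EuclideanSpace ℝ (Fin n) →ᵇ ℝ) (h : Lp ℝ 2 μ)
    (A : EuclideanSpace ℝ (Fin n) →L[ℝ] EuclideanSpace ℝ (Fin n)) (b : EuclideanSpace ℝ (Fin n)) :
    ∫ x, condProj μ E h x * f (A x + b) ∂μ
      = ∫ y, ∫ x, h x * f ((A ∘L E.starProjection) x + (A (Eᗮ.starProjection y) + b)) ∂μ ∂μ := by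
  have hφ := memLp_pullback (μ := μ) f A b
  have hfst := (Lp.memLp h).comp_measurePreserving (measurePreserving_fst (μ := μ) (ν := μ))
  have hmix := hφ.comp_measurePreserving hE.measurePreserving_mixProj
  calc ∫ x, condProj μ E h x * f (A x + b) ∂μ
      = inner ℝ (condProj μ E (hφ.toLp _)) h := by
        rw [← inner_toLp_eq_integral _ hφ, inner_condProj_left, real_inner_comm]
    _ = ∫ p, hφ.toLp _ (mixProj E p.1 p.2) * h p.1 ∂(μ.prod μ) := hE.inner_condProj _ _
    _ = ∫ p, h p.1 * f (A (mixProj E p.1 p.2) + b) ∂(μ.prod μ) := by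
        refine integral_congr_ae ?_
        filter_upwards [hE.measurePreserving_mixProj.quasiMeasurePreserving.ae_eq_comp
          hφ.coeFn_toLp] with p hp
        rw [mul_comm]
        exact congrArg (h p.1 * ·) hp
    _ = ∫ y, ∫ x, h x * f (A (mixProj E x y) + b) ∂μ ∂μ :=
        integral_prod_symm _ (hfst.integrable_mul hmix)
    _ = _ := by simp only [mixProj, map_add, add_assoc, ContinuousLinearMap.comp_apply]

theorem PullbackBound.abs_integral_condProj_le {h : Lp ℝ 2 μ} {K : ℝ}
    (hK : PullbackBound μ f h K) {E : Submodule ℝ (EuclideanSpace ℝ (Fin n))}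
    (hE : SplitsAlong μ E) (A : EuclideanSpace ℝ (Fin n) →L[ℝ] EuclideanSpace ℝ (Fin n))
    (b : EuclideanSpace ℝ (Fin n)) :
    |∫ x, condProj μ E h x * f (A x + b) ∂μ| ≤ K * hilbertSchmidtSq (A ∘L E.starProjection) := by
  rw [hE.integral_condProj_mul_pullback, ← Real.norm_eq_abs]
  exact (norm_integral_le_of_norm_le_const (C := K * hilbertSchmidtSq (A ∘L E.starProjection))
    (.of_forall fun y => hK _ _)).trans_eq (by simp)

variable {ξ : Measure (Submodule ℝ (EuclideanSpace ℝ (Fin n)))} [IsProbabilityMeasure ξ] {lam : ℝ}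

theorem PullbackBound.averageCondProj_apply {h : Lp ℝ 2 μ} {K : ℝ} (hK : PullbackBound μ f h K)
    (hK0 : 0 ≤ K) (hframe : FrameBound ξ lam) (hsplit : SplitsWrt μ ξ) :
    PullbackBound μ f (averageCondProj hsplit h) ((1 - lam) * K) := by
  intro A b
  have hφ := memLp_pullback (μ := μ) f A b
  calc |∫ x, averageCondProj hsplit h x * f (A x + b) ∂μ|
      = ‖∫ E, inner ℝ (condProj μ E h) (hφ.toLp _) ∂ξ‖ := by
        rw [← inner_toLp_eq_integral _ hφ, inner_averageCondProj, Real.norm_eq_abs]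
    _ ≤ ∫ E : Submodule ℝ (EuclideanSpace ℝ (Fin n)),
          K * hilbertSchmidtSq (A ∘L E.starProjection) ∂ξ := by
        refine norm_integral_le_of_norm_le
          ((integrable_hilbertSchmidtSq_comp_starProjection A).const_mul K) ?_
        filter_upwards [hsplit] with E hE
        rw [inner_toLp_eq_integral _ hφ]
        exact hK.abs_integral_condProj_le hE A b
    _ ≤ K * ((1 - lam) * hilbertSchmidtSq A) := by
        rw [integral_const_mul]
        gcongr
        exact hframe.integral_hilbertSchmidtSq_le A
    _ = (1 - lam) * K * hilbertSchmidtSq A := by ring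

theorem AffineFree.toLp_mem_geometricDecay {g : 𝓓((⊤ : Opens (EuclideanSpace ℝ (Fin n))), ℝ)}
    (hfree : AffineFree μ g) (hg : MemLp g 2 μ) (hframe : FrameBound ξ lam) (hr : 0 ≤ 1 - lam)
    (hsplit : SplitsWrt μ ξ) :
    hg.toLp g ∈ geometricDecay (averageCondProj hsplit) (1 - lam) := by
  obtain ⟨K, hK0, hK⟩ := exists_pullbackBound (g.contDiff.of_le (WithTop.coe_le_coe.2 le_top))
    g.hasCompactSupport g.continuous g.hasCompactSupport hfree
  have hiter (k : ℕ) : PullbackBound μ (g : EuclideanSpace ℝ (Fin n) →ᵇ ℝ)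
      ((averageCondProj hsplit ^ k) (hg.toLp g)) ((1 - lam) ^ k * K) := by
    induction k with
    | zero =>
      intro A b
      have hcongr : ∫ x, hg.toLp g x * g (A x + b) ∂μ = ∫ x, g x * g (A x + b) ∂μ := by
        refine integral_congr_ae ?_
        filter_upwards [hg.coeFn_toLp] with x hx
        rw [hx]
      rw [pow_zero (1 - lam), one_mul]
      exact (congrArg abs hcongr).trans_le (hK A b)
    | succ k ih =>
      rw [pow_succ', pow_succ', mul_assoc]
      exact ih.averageCondProj_apply (by positivity) hframe hsplit
  refine mem_geometricDecay_of_inner_le (isSelfAdjoint_averageCondProj hsplit) hr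
    (C := K * hilbertSchmidtSq (.id ℝ (EuclideanSpace ℝ (Fin n)))) fun k => ?_
  rw [inner_toLp_eq_integral]
  have hid := hiter k (.id ℝ _) 0
  simp only [ContinuousLinearMap.id_apply, add_zero] at hid
  refine (le_abs_self _).trans (hid.trans_eq ?_)
  ring

end PullbackAverage

section Centering

section General

variable {S : Type*} [MeasurableSpace S] {μ : Measure S} [IsProbabilityMeasure μ] {f g : S → ℝ}

/-- The centered function `f - ∫ f dμ`, as an element of `L²(μ)`. -/
noncomputable def centeredLp (hf : MemLp f 2 μ) : Lp ℝ 2 μ :=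
  (hf.sub (memLp_const (∫ x, f x ∂μ))).toLp _

theorem centeredLp_ae_eq (hf : MemLp f 2 μ) : centeredLp hf =ᵐ[μ] fun x => f x - ∫ y, f y ∂μ :=
  (hf.sub (memLp_const _)).coeFn_toLp

theorem integral_centeredLp (hf : MemLp f 2 μ) : ∫ x, centeredLp hf x ∂μ = 0 := by
  rw [integral_congr_ae (centeredLp_ae_eq hf),
    integral_sub (hf.integrable one_le_two) (integrable_const _)]
  simp

theorem norm_centeredLp_sq (hf : MemLp f 2 μ) : ‖centeredLp hf‖ ^ 2 = Var[f; μ] := by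
  rw [variance_eq_integral hf.aemeasurable, ← real_inner_self_eq_norm_sq, L2.inner_def]
  refine integral_congr_ae ?_
  filter_upwards [centeredLp_ae_eq hf] with x hx
  rw [hx, real_inner_self_eq_norm_sq, Real.norm_eq_abs, sq_abs]

theorem centeredLp_eq_of_ae_eq_const_add (hf : MemLp f 2 μ) (hg : MemLp g 2 μ) {c : ℝ}
    (h : g =ᵐ[μ] fun x => c + f x) : centeredLp hg = centeredLp hf := by
  have hmean : ∫ x, g x ∂μ = c + ∫ x, f x ∂μ := by
    rw [integral_congr_ae h, integral_add (integrable_const c) (hf.integrable one_le_two)]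
    simp
  refine Lp.ext ?_
  filter_upwards [centeredLp_ae_eq hf, centeredLp_ae_eq hg, h] with x hfx hgx hx
  rw [hfx, hgx, hx, hmean, add_sub_add_left_eq_sub]

theorem ae_eq_integral_add_centeredLp (h : Lp ℝ 2 μ) :
    h =ᵐ[μ] fun x => ∫ y, h y ∂μ + centeredLp (Lp.memLp h) x := by
  filter_upwards [centeredLp_ae_eq (Lp.memLp h)] with x hx
  rw [hx, add_sub_cancel]

theorem inner_centeredLp (h : Lp ℝ 2 μ) :
    inner ℝ h (centeredLp (Lp.memLp h)) = ‖centeredLp (Lp.memLp h)‖ ^ 2 := by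
  set l := centeredLp (Lp.memLp h)
  have hint : Integrable l μ := (Lp.memLp l).integrable one_le_two
  have hsq : Integrable (fun x => l x * l x) μ := (Lp.memLp l).integrable_mul (Lp.memLp l)
  calc inner ℝ h l = ∫ x, l x * h x ∂μ := L2.inner_def _ _
    _ = ∫ x, l x * ∫ y, h y ∂μ + l x * l x ∂μ := by
        refine integral_congr_ae ?_
        filter_upwards [ae_eq_integral_add_centeredLp h] with x hx
        rw [← mul_add, ← hx]
    _ = ∫ x, l x * l x ∂μ := by
        rw [integral_add (hint.mul_const _) hsq, integral_mul_const,
          integral_centeredLp (Lp.memLp h), zero_mul, zero_add]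
    _ = ‖l‖ ^ 2 := (L2.inner_def l l).symm.trans (real_inner_self_eq_norm_sq l)

end General

theorem condProj_centeredLp {n : ℕ} {μ : Measure (EuclideanSpace ℝ (Fin n))}
    [IsProbabilityMeasure μ] {f : EuclideanSpace ℝ (Fin n) → ℝ} (hf : MemLp f 2 μ)
    (E : Submodule ℝ (EuclideanSpace ℝ (Fin n))) :
    condProj μ E (centeredLp hf)
      = centeredLp (f := μ[f | sigmaProj id E]) (hf.condExp one_le_two) := by
  have hle := sigmaProj_id_le E
  have hsub : μ[fun x => f x - ∫ y, f y ∂μ | sigmaProj id E] =ᵐ[μ]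
      fun x => (μ[f | sigmaProj id E]) x - ∫ y, f y ∂μ := by
    refine (condExp_sub (hf.integrable one_le_two) (integrable_const _) _).trans ?_
    rw [condExp_const hle]
    rfl
  have hcond := (condProj_ae_eq E _).trans ((condExp_congr_ae (centeredLp_ae_eq hf)).trans hsub)
  have hcenter := centeredLp_ae_eq (f := μ[f | sigmaProj id E]) (hf.condExp one_le_two)
  rw [integral_condExp hle] at hcenter
  exact Lp.ext (hcond.trans hcenter.symm)

end Centering

section CenteredInner

section Definitions

variable {F : Type*} [NormedAddCommGroup F] [InnerProductSpace ℝ F] [MeasurableSpace F]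

/-- The vectors `v` for which the linear functional `⟨v, ·⟩` is square integrable. -/
def squareIntegrableSpace (μ : Measure F) : Submodule ℝ F where
  carrier := {v | MemLp (fun x => inner ℝ v x) 2 μ}
  add_mem' ha hb := by
    simp only [Set.mem_ofPred_eq, inner_add_left] at ha hb ⊢
    exact ha.add hb
  zero_mem' := by simp
  smul_mem' c v hv := by
    simp only [Set.mem_ofPred_eq, real_inner_smul_left] at hv ⊢
    exact hv.const_mul c

variable (μ : Measure F) [IsProbabilityMeasure μ]

theorem integrable_inner_squareIntegrableSpace (v : squareIntegrableSpace μ) :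
    Integrable (fun x => inner ℝ v.1 x) μ :=
  MemLp.integrable one_le_two v.2

/-- The centered linear functionals in `L²(μ)`. -/
noncomputable def centeredInner : squareIntegrableSpace μ →ₗ[ℝ] Lp ℝ 2 μ where
  toFun v := centeredLp v.2
  map_add' v w := by
    dsimp only [centeredLp]
    rw [← MemLp.toLp_add, MemLp.toLp_eq_toLp_iff]
    refine .of_forall fun x => ?_
    simp only [Submodule.coe_add, inner_add_left, Pi.add_apply, Pi.sub_apply]
    rw [integral_add (integrable_inner_squareIntegrableSpace μ v)
      (integrable_inner_squareIntegrableSpace μ w)]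
    ring
  map_smul' c v := by
    dsimp only [centeredLp]
    rw [RingHom.id_apply, ← MemLp.toLp_const_smul, MemLp.toLp_eq_toLp_iff]
    refine .of_forall fun x => ?_
    simp only [Submodule.coe_smul, real_inner_smul_left, Pi.smul_apply, Pi.sub_apply, smul_eq_mul]
    rw [integral_const_mul]
    ring

variable [FiniteDimensional ℝ F]

/-- `centeredInner`, extended to all vectors by projecting to `squareIntegrableSpace μ`. -/
noncomputable def centeredInnerProj : F →L[ℝ] Lp ℝ 2 μ :=
  LinearMap.toContinuousLinearMap (centeredInner μ) ∘L
    (squareIntegrableSpace μ).orthogonalProjectionOnto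

theorem centeredInnerProj_coe (v : squareIntegrableSpace μ) :
    centeredInnerProj μ v = centeredInner μ v := by
  simp [centeredInnerProj]

variable {μ}

theorem centeredLp_mem_range_centeredInner (h : Lp ℝ 2 μ) {c : ℝ} {ℓ : F →L[ℝ] ℝ}
    (hcℓ : h =ᵐ[μ] fun x => c + ℓ x) :
    centeredLp (Lp.memLp h) ∈ LinearMap.range (centeredInner μ) := by
  obtain ⟨v, rfl⟩ := (InnerProductSpace.toDual ℝ F).surjective ℓ
  simp only [InnerProductSpace.toDual_apply_apply] at hcℓ
  have hv : v ∈ squareIntegrableSpace μ := by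
    refine ((Lp.memLp h).sub (memLp_const c)).ae_eq ?_
    filter_upwards [hcℓ] with x hx
    simp [hx]
  exact ⟨⟨v, hv⟩, (centeredLp_eq_of_ae_eq_const_add hv (Lp.memLp h) hcℓ).symm⟩

end Definitions

variable {n : ℕ} {μ : Measure (EuclideanSpace ℝ (Fin n))} [IsProbabilityMeasure μ]

theorem SplitsAlong.starProjection_mem_squareIntegrableSpace
    {E : Submodule ℝ (EuclideanSpace ℝ (Fin n))} (hE : SplitsAlong μ E)
    {v : EuclideanSpace ℝ (Fin n)} (hv : v ∈ squareIntegrableSpace μ) :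
    E.starProjection v ∈ squareIntegrableSpace μ := by
  have hmix : MemLp (fun p : EuclideanSpace ℝ (Fin n) × EuclideanSpace ℝ (Fin n) =>
      inner ℝ v (mixProj E p.1 p.2)) 2 (μ.prod μ) :=
    MemLp.comp_measurePreserving hv hE.measurePreserving_mixProj
  obtain ⟨x, hx⟩ := hmix.integrable_sq.prod_right_ae.exists
  have hslice : MemLp (fun y => inner ℝ v (mixProj E x y)) 2 μ := by
    refine (memLp_two_iff_integrable_sq ?_).2 hx
    simp only [mixProj]
    fun_prop
  have hcompl : v - E.starProjection v ∈ squareIntegrableSpace μ := by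
    refine (hslice.sub (memLp_const (inner ℝ (E.starProjection v) x))).ae_eq
      (.of_forall fun y => ?_)
    simp [inner_mixProj]
  simpa only [sub_sub_cancel] using (squareIntegrableSpace μ).sub_mem hv hcompl

theorem SplitsAlong.condProj_centeredInner {E : Submodule ℝ (EuclideanSpace ℝ (Fin n))}
    (hE : SplitsAlong μ E) (v : squareIntegrableSpace μ) :
    condProj μ E (centeredInner μ v) = centeredInnerProj μ (E.starProjection v.1) := by
  obtain ⟨w, hw⟩ : ∃ w : squareIntegrableSpace μ, w.1 = E.starProjection v.1 :=
    ⟨⟨_, hE.starProjection_mem_squareIntegrableSpace v.2⟩, rfl⟩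
  have hv := integrable_inner_squareIntegrableSpace μ v
  have hsub : Integrable (fun y => inner ℝ v.1 y - inner ℝ w.1 y) μ :=
    hv.sub (integrable_inner_squareIntegrableSpace μ w)
  rw [← hw, centeredInnerProj_coe]
  refine (condProj_centeredLp v.2 E).trans (centeredLp_eq_of_ae_eq_const_add w.2 _
    (c := ∫ y, (inner ℝ v.1 y - inner ℝ w.1 y) ∂μ) ?_)
  refine (hE.condExp_ae_eq hv).trans (.of_forall fun x => ?_)
  calc ∫ y, inner ℝ v.1 (mixProj E x y) ∂μ
      = ∫ y, inner ℝ w.1 x + (inner ℝ v.1 y - inner ℝ w.1 y) ∂μ := by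
        simp [inner_mixProj, hw, inner_sub_left]
    _ = ∫ y, (inner ℝ v.1 y - inner ℝ w.1 y) ∂μ + inner ℝ w.1 x := by
        rw [integral_add (integrable_const _) hsub, add_comm]
        simp

variable {ξ : Measure (Submodule ℝ (EuclideanSpace ℝ (Fin n)))} [IsProbabilityMeasure ξ]

theorem averageCondProj_comp_centeredInnerProj (hsplit : SplitsWrt μ ξ) :
    averageCondProj hsplit ∘L centeredInnerProj μ = centeredInnerProj μ ∘L
      ((∫ E : Submodule ℝ (EuclideanSpace ℝ (Fin n)), E.starProjection ∂ξ) ∘L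
        (squareIntegrableSpace μ).starProjection) := by
  ext1 w
  refine ext_inner_right ℝ fun g => ?_
  set z := (squareIntegrableSpace μ).orthogonalProjectionOnto w
  have hint := (integrable_starProjection (ξ := ξ)).apply_continuousLinearMap z.1
  calc inner ℝ (averageCondProj hsplit (centeredInnerProj μ w)) g
      = ∫ E, inner ℝ (condProj μ E (centeredInner μ z)) g ∂ξ := inner_averageCondProj hsplit _ g
    _ = ∫ E : Submodule ℝ (EuclideanSpace ℝ (Fin n)),
          inner ℝ (centeredInnerProj μ (E.starProjection z.1)) g ∂ξ := by
        refine integral_congr_ae ?_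
        filter_upwards [hsplit] with E hE
        rw [hE.condProj_centeredInner]
    _ = inner ℝ (∫ E : Submodule ℝ (EuclideanSpace ℝ (Fin n)),
          centeredInnerProj μ (E.starProjection z.1) ∂ξ) g := by
        rw [real_inner_comm, ← integral_inner ((centeredInnerProj μ).integrable_comp hint)]
        simp only [real_inner_comm]
    _ = inner ℝ (centeredInnerProj μ
          ((∫ E : Submodule ℝ (EuclideanSpace ℝ (Fin n)), E.starProjection ∂ξ) z.1)) g := by
        rw [ContinuousLinearMap.integral_comp_comm _ hint,
          ContinuousLinearMap.integral_apply integrable_starProjection]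

theorem centeredInner_mem_geometricDecay {lam : ℝ} (hframe : FrameBound ξ lam) (hr : 0 ≤ 1 - lam)
    (hsplit : SplitsWrt μ ξ) (v : squareIntegrableSpace μ) :
    centeredInner μ v ∈ geometricDecay (averageCondProj hsplit) (1 - lam) := by
  rw [← centeredInnerProj_coe]
  refine mem_geometricDecay_of_intertwines (averageCondProj_comp_centeredInnerProj hsplit) hr
    (fun w => (hframe.norm_integral_apply_le hr _).trans ?_) v.1
  gcongr
  exact Submodule.norm_starProjection_apply_le _ _

end CenteredInner

section Contraction

open TopologicalSpace (Opens)
open scoped Distributions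

variable {n : ℕ} {μ : Measure (EuclideanSpace ℝ (Fin n))} [IsProbabilityMeasure μ]
  {ξ : Measure (Submodule ℝ (EuclideanSpace ℝ (Fin n)))} [IsProbabilityMeasure ξ] {lam : ℝ}

theorem FrameBound.subsingleton (hframe : FrameBound ξ lam) (hr : 1 - lam < 0) :
    Subsingleton (EuclideanSpace ℝ (Fin n)) := by
  refine subsingleton_of_forall_eq 0 fun u => ?_
  have hnonneg : 0 ≤ (1 - lam) * ‖u‖ ^ 2 :=
    (integral_nonneg fun E => by positivity).trans (hframe.integral_norm_sq_le u)
  simpa using le_antisymm (nonpos_of_mul_nonneg_right hnonneg hr) (sq_nonneg ‖u‖)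

theorem ae_eq_integral_of_mem_geometricDecay_orthogonal (hframe : FrameBound ξ lam)
    (hr : 0 ≤ 1 - lam) (hsplit : SplitsWrt μ ξ) {h : Lp ℝ 2 μ}
    (hh : h ∈ (geometricDecay (averageCondProj hsplit) (1 - lam))ᗮ) :
    h =ᵐ[μ] fun _ => ∫ y, h y ∂μ := by
  have hi : Integrable h μ := (Lp.memLp h).integrable one_le_two
  obtain ⟨c, ℓ, hcℓ⟩ := ae_eq_affine_of_integral_testFunction_eq_zero hi.locallyIntegrable
    fun g hfree => by
      have hg : MemLp g 2 μ := g.memLp_top.mono_exponent le_top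
      have horth := (Submodule.mem_orthogonal' _ _).1 hh _
        (hfree.toLp_mem_geometricDecay hg hframe hr hsplit)
      rw [inner_toLp_eq_integral] at horth
      simpa only [mul_comm] using horth
  obtain ⟨v, hv⟩ := centeredLp_mem_range_centeredInner h hcℓ
  have hnorm : ‖centeredLp (Lp.memLp h)‖ ^ 2 = 0 := by
    rw [← inner_centeredLp, ← hv]
    exact (Submodule.mem_orthogonal' _ _).1 hh _
      (centeredInner_mem_geometricDecay hframe hr hsplit v)
  have hzero : centeredLp (Lp.memLp h) = 0 := by simpa using hnorm
  filter_upwards [ae_eq_integral_add_centeredLp h, hzero ▸ Lp.coeFn_zero ℝ 2 μ] with x hx hx'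
  rw [hx, hx', Pi.zero_apply, add_zero]

theorem mem_closure_geometricDecay (hframe : FrameBound ξ lam) (hr : 0 ≤ 1 - lam)
    (hsplit : SplitsWrt μ ξ) {f : Lp ℝ 2 μ} (hf : ∫ x, f x ∂μ = 0) :
    f ∈ (geometricDecay (averageCondProj hsplit) (1 - lam)).topologicalClosure := by
  rw [← Submodule.orthogonal_orthogonal_eq_closure]
  refine (Submodule.mem_orthogonal _ _).2 fun h hh => ?_
  calc inner ℝ h f = ∫ x, f x * h x ∂μ := L2.inner_def _ _
    _ = ∫ x, f x * ∫ y, h y ∂μ ∂μ := by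
        refine integral_congr_ae ?_
        filter_upwards [ae_eq_integral_of_mem_geometricDecay_orthogonal hframe hr hsplit hh]
          with x hx
        rw [hx]
    _ = 0 := by rw [integral_mul_const, hf, zero_mul]

theorem inner_averageCondProj_self_le (hframe : FrameBound ξ lam) (hsplit : SplitsWrt μ ξ)
    {f : Lp ℝ 2 μ} (hf : ∫ x, f x ∂μ = 0) :
    inner ℝ (averageCondProj hsplit f) f ≤ (1 - lam) * ‖f‖ ^ 2 := by
  rcases le_or_gt 0 (1 - lam) with hr | hr
  · have hnorm := norm_apply_le_of_mem_closure_geometricDecay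
      (isSelfAdjoint_averageCondProj hsplit) hr (mem_closure_geometricDecay hframe hr hsplit hf)
    calc inner ℝ (averageCondProj hsplit f) f ≤ ‖averageCondProj hsplit f‖ * ‖f‖ :=
          real_inner_le_norm _ _
      _ ≤ (1 - lam) * ‖f‖ * ‖f‖ := by gcongr
      _ = (1 - lam) * ‖f‖ ^ 2 := by ring
  · have := hframe.subsingleton hr
    have hconst (x : EuclideanSpace ℝ (Fin n)) : f x = 0 := by
      simpa only [fun y => congrArg f (Subsingleton.elim y x), integral_const, probReal_univ,
        one_smul] using hf
    have hzero : f = 0 := by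
      refine Lp.ext ?_
      filter_upwards [Lp.coeFn_zero ℝ 2 μ] with x hx
      rw [hx, hconst, Pi.zero_apply]
    simp [hzero]

end Contraction

section Variance

variable {n : ℕ} {μ : Measure (EuclideanSpace ℝ (Fin n))}
  {Ω : Type*} [MeasurableSpace Ω] {P : Measure Ω} [IsProbabilityMeasure P]
  {X : Ω → EuclideanSpace ℝ (Fin n)} {f : EuclideanSpace ℝ (Fin n) → ℝ}

theorem expCondVar_eq_sub (hX : MeasurePreserving X P μ) (hf : MemLp f 2 μ)
    (E : Submodule ℝ (EuclideanSpace ℝ (Fin n))) :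
    expCondVar P X f E = Var[fun ω => f (X ω); P] - varCondExp P X f E := by
  have hle : sigmaProj X E ≤ ‹MeasurableSpace Ω› :=
    (E.starProjection.measurable.comp hX.measurable).comap_le
  exact eq_sub_of_add_eq
    (integral_condVar_add_variance_condExp hle (hf.comp_measurePreserving hX))

variable [IsProbabilityMeasure μ]

theorem varCondExp_eq_variance_condExp (hX : MeasurePreserving X P μ) (hf : Integrable f μ)
    (E : Submodule ℝ (EuclideanSpace ℝ (Fin n))) :
    varCondExp P X f E = Var[μ[f | sigmaProj id E]; μ] := by
  obtain ⟨hXm, rfl⟩ := hX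
  have hσ : sigmaProj X E = (sigmaProj id E).comap X := by
    rw [MeasurableSpace.comap_comp]
    rfl
  rw [varCondExp, hσ, variance_congr (condExp_comp_ae_eq hXm (sigmaProj_id_le E) hf),
    variance_map integrable_condExp.aestronglyMeasurable.aemeasurable hXm.aemeasurable]
  rfl

theorem varCondExp_eq_inner (hX : MeasurePreserving X P μ) (hf : MemLp f 2 μ)
    (E : Submodule ℝ (EuclideanSpace ℝ (Fin n))) :
    varCondExp P X f E = inner ℝ (condProj μ E (centeredLp hf)) (centeredLp hf) := by
  rw [varCondExp_eq_variance_condExp hX (hf.integrable one_le_two), inner_condProj_self,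
    condProj_centeredLp, norm_centeredLp_sq]

variable {ξ : Measure (Submodule ℝ (EuclideanSpace ℝ (Fin n)))} [IsProbabilityMeasure ξ]

theorem integrable_varCondExp (hsplit : SplitsWrt μ ξ) (hX : MeasurePreserving X P μ)
    (hf : MemLp f 2 μ) : Integrable (fun E => varCondExp P X f E) ξ := by
  simp only [varCondExp_eq_inner hX hf]
  exact hsplit.integrable_inner_condProj _ _

theorem integrable_expCondVar (hsplit : SplitsWrt μ ξ) (hX : MeasurePreserving X P μ)
    (hf : MemLp f 2 μ) : Integrable (fun E => expCondVar P X f E) ξ := by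
  simp only [expCondVar_eq_sub hX hf]
  exact (integrable_const _).sub (integrable_varCondExp hsplit hX hf)

theorem integral_expCondVar (hsplit : SplitsWrt μ ξ) (hX : MeasurePreserving X P μ)
    (hf : MemLp f 2 μ) : ∫ E, expCondVar P X f E ∂ξ
      = Var[fun ω => f (X ω); P] - ∫ E, varCondExp P X f E ∂ξ := by
  simp only [expCondVar_eq_sub hX hf]
  rw [integral_sub (integrable_const _) (integrable_varCondExp hsplit hX hf)]
  simp

theorem integral_varCondExp_le {lam : ℝ} (hframe : FrameBound ξ lam) (hsplit : SplitsWrt μ ξ)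
    (hX : MeasurePreserving X P μ) (hf : MemLp f 2 μ) :
    ∫ E, varCondExp P X f E ∂ξ ≤ (1 - lam) * Var[fun ω => f (X ω); P] := by
  have hvar : ‖centeredLp hf‖ ^ 2 = Var[fun ω => f (X ω); P] := by
    obtain ⟨hXm, rfl⟩ := hX
    exact (norm_centeredLp_sq hf).trans (variance_map hf.aemeasurable hXm.aemeasurable)
  simp only [varCondExp_eq_inner hX hf]
  rw [← inner_averageCondProj hsplit, ← hvar]
  exact inner_averageCondProj_self_le hframe hsplit (integral_centeredLp hf)

end Variance

theorem theorem4 {n : ℕ}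
    (μ : Measure (EuclideanSpace ℝ (Fin n))) [IsProbabilityMeasure μ]
    (ξ : Measure (Submodule ℝ (EuclideanSpace ℝ (Fin n)))) [IsProbabilityMeasure ξ]
    (lam : ℝ) (hlam : 0 ≤ lam) (hframe : FrameBound ξ lam) (hsplit : SplitsWrt μ ξ)
    {Ω : Type*} [MeasurableSpace Ω] (P : Measure Ω) [IsProbabilityMeasure P]
    (X : Ω → EuclideanSpace ℝ (Fin n)) (hX : Measurable X) (hXμ : P.map X = μ)
    (f : EuclideanSpace ℝ (Fin n) → ℝ) (hf : MemLp f 2 μ) :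
    -- both integrals over the space of subspaces are well defined
    Integrable (fun E => varCondExp P X f E) ξ ∧
    Integrable (fun E => expCondVar P X f E) ξ ∧
    -- the first inequality
    ∫ E, varCondExp P X f E ∂ξ ≤ (1 - lam) * Var[fun ω => f (X ω); P] ∧
    -- the second inequality
    (0 < lam → Var[fun ω => f (X ω); P] ≤ (1 / lam) * ∫ E, expCondVar P X f E ∂ξ) ∧
    -- the two inequalities are equivalent, for any constant `c > 0` in place of `lam`
    (∀ c : ℝ, 0 < c →
      (∫ E, varCondExp P X f E ∂ξ ≤ (1 - c) * Var[fun ω => f (X ω); P] ↔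
        Var[fun ω => f (X ω); P] ≤ (1 / c) * ∫ E, expCondVar P X f E ∂ξ)) := by
  have hXP : MeasurePreserving X P μ := ⟨hX, hXμ⟩
  have hle := integral_varCondExp_le hframe hsplit hXP hf
  have hequiv (c : ℝ) (hc : 0 < c) :
      ∫ E, varCondExp P X f E ∂ξ ≤ (1 - c) * Var[fun ω => f (X ω); P] ↔
        Var[fun ω => f (X ω); P] ≤ (1 / c) * ∫ E, expCondVar P X f E ∂ξ := by
    rw [integral_expCondVar hsplit hXP hf, one_div, inv_mul_eq_div, le_div_iff₀ hc]
    constructor <;> intro h <;> linarith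
  exact ⟨integrable_varCondExp hsplit hXP hf, integrable_expCondVar hsplit hXP hf, hle,
    fun hl => (hequiv lam hl).1 hle, hequiv⟩
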